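/- Let $G$ be a second countable étale groupoid (a locally compact Hausdorff topological groupoid whose range map $r$ is a local homeomorphism) whose unit space $G^{(0)}$ is compact and totally disconnected; $s$ denotes the source map. For $C, K\subset G$ and $x\in G^{(0)}$ put $Kx=\{k\in K: s(k)=x\}$, $K(x)=r(Kx)$ and $CKx=\{ck: c\in C,\ k\in Kx,\ s(c)=r(k)\}$. An *elementary subgroupoid* is a compact open subgroupoid $K\subset G$ that contains $G^{(0)}$ and in which every element $g$ with $r(g)=s(g)$ is a unit. Suppose that * $G$ is *almost finite*: for every compact $C\subset G$ and every $\varepsilon>0$ there is an elementary subgroupoid $K\subset G$ with $|CKx\setminus Kx|<\varepsilon\,|K(x)|$ for all $x\in G^{(0)}$; * $G$ is *minimal*: for every $x\in G^{(0)}$ the orbit $G(x)=\{r(g): g\in G,\ s(g)=x\}$ is dense in $G^{(0)}$. Let $H_0(G)=C(G^{(0)},\mathbb Z)/\operatorname{Im}\delta_1$, where $\delta_1:C_c(G,\mathbb Z)\to C(G^{(0)},\mathbb Z)$ is $$\delta_1(f)(x)=\sum_{s(g)=x}f(g)-\sum_{r(g)=x}f(g),$$ and let $H_0(G)^+=\{[f]: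 f\in C(G^{(0)},\mathbb Z),\ f\ge 0\}$. For $a,b\in H_0(G)$ write $a\le b$ if $b-a\in H_0(G)^+$, and $a<b$ if moreover $a\neq b$. Then: 1. $(H_0(G),H_0(G)^+)$ is an ordered abelian group: $H_0(G)^++H_0(G)^+\subset H_0(G)^+$, $H_0(G)^+\cap(-H_0(G)^+)=\{0\}$ and $H_0(G)^+-H_0(G)^+=H_0(G)$. 2. It is simple: every $u>0$ is an order unit, i.e. for every $a\in H_0(G)$ there is $n\in\mathbb N$ with $-nu\le a\le nu$. 3. It is weakly unperforated: if $a\in H_0(G)$ and $na>0$ for some integer $n\ge1$, then $a>0$. 4. It has the Riesz interpolation property: if $a_1,a_2,b_1,b_2\in H_0(G)$ satisfy $a_i\le b_j$ for all $i,j\in\{1,2\}$, then there is $c\in H_0(G)$ with $a_i\le c\le b_j$ for all $i,j\in\{1,2\}$. -/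

import Mathlib

open scoped CompactlySupported

/-! ### Compactly supported integer functions and push-forward along étale maps -/

theorem finite_fiber_inter_isCompact {X Y : Type*} [TopologicalSpace X] [TopologicalSpace Y]
    [T1Space Y] {π : X → Y} (hπ : IsLocalHomeomorph π) {S : Set X} (hS : IsCompact S) (y : Y) :
    (π ⁻¹' {y} ∩ S).Finite := by
  have hcl : IsClosed (π ⁻¹' {y}) := isClosed_singleton.preimage hπ.continuous
  have hc : IsCompact (π ⁻¹' {y} ∩ S) := hS.inter_left hcl
  by_contra hinf
  obtain ⟨x, -, hx⟩ := Set.Infinite.exists_accPt_of_subset_isCompact hinf hc subset_rfl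
  obtain ⟨e, hxe, he⟩ := hπ x
  have h1 := (accPt_iff_nhds.1 hx) e.source (e.open_source.mem_nhds hxe)
  obtain ⟨z, ⟨hz1, hz2⟩, hzx⟩ := h1
  have hxF : x ∈ π ⁻¹' {y} := by
    have : x ∈ closure (π ⁻¹' {y} ∩ S) := hx.clusterPt.mem_closure
    exact hcl.closure_subset_iff.2 Set.inter_subset_left this
  apply hzx
  apply e.injOn hz1 hxe
  rw [← he]
  exact hz2.1.trans hxF.symm

/-- `π_*(f)(y) = ∑_{π(x) = y} f(x)`. -/
noncomputable def pushforwardFun {X Y : Type*} (π : X → Y) (f : X → ℤ) (y : Y) : ℤ :=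
  ∑ᶠ x ∈ π ⁻¹' {y}, f x

theorem pushforwardFun_continuous {X Y : Type*} [TopologicalSpace X] [TopologicalSpace Y]
    [T2Space X] [T2Space Y] {π : X → Y} (hπ : IsLocalHomeomorph π) (f : C_c(X, ℤ)) :
    Continuous (pushforwardFun π f) := by
  rw [← IsLocallyConstant.iff_continuous, IsLocallyConstant.iff_eventually_eq]
  intro y
  have hS : IsCompact (tsupport f) := f.hasCompactSupport
  set F := π ⁻¹' {y} ∩ tsupport f with hF
  have hfin : F.Finite := finite_fiber_inter_isCompact hπ hS y
  obtain ⟨U, hU, hdisj⟩ := hfin.t2_separation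
  choose e hxe he using hπ
  let W : X → Set X := fun x => U x ∩ (e x).source ∩ f ⁻¹' {f x}
  have hWo : ∀ x, IsOpen (W x) := fun x =>
    ((hU x).2.inter (e x).open_source).inter ((isOpen_discrete _).preimage f.continuous)
  have hWx : ∀ x, x ∈ W x := fun x => ⟨⟨(hU x).1, hxe x⟩, rfl⟩
  have hinj : ∀ x, Set.InjOn π (W x) := fun x => by
    rw [he x]; exact (e x).injOn.mono fun z hz => hz.1.2
  have hπ' : IsLocalHomeomorph π := fun x => ⟨e x, hxe x, he x⟩
  let V : Set Y := (⋂ x ∈ F, π '' W x) ∩ (π '' (tsupport f \ ⋃ x ∈ F, W x))ᶜ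
  have hVo : IsOpen V := by
    refine (hfin.isOpen_biInter fun x _ => hπ'.isOpenMap _ (hWo x)).inter ?_
    refine IsCompact.isClosed ?_ |>.isOpen_compl
    exact (hS.diff (isOpen_biUnion fun x _ => hWo x)).image hπ'.continuous
  have hyV : y ∈ V := by
    refine ⟨Set.mem_iInter₂.2 fun x hx => ⟨x, hWx x, hx.1⟩, ?_⟩
    rintro ⟨z, ⟨hz, hz'⟩, hzy⟩
    exact hz' (Set.mem_biUnion (show z ∈ F from ⟨hzy, hz⟩) (hWx z))
  have key : ∀ y' ∈ V, pushforwardFun π f y' = ∑ᶠ x ∈ F, f x := by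
    intro y' hy'
    have h1 : ∀ x : X, ∃ z, x ∈ F → z ∈ W x ∧ π z = y' := fun x => by
      by_cases hx : x ∈ F
      · obtain ⟨z, hz⟩ := Set.mem_iInter₂.1 hy'.1 x hx
        exact ⟨z, fun _ => hz⟩
      · exact ⟨x, fun h => (hx h).elim⟩
    choose σ hσ using h1
    have h2 : ∑ᶠ x ∈ F, f x = ∑ᶠ z ∈ π ⁻¹' {y'} ∩ ⋃ x ∈ F, W x, f z := by
      refine finsum_mem_eq_of_bijOn σ ⟨?_, ?_, ?_⟩ ?_
      · intro x hx
        exact ⟨(hσ x hx).2, Set.mem_biUnion hx (hσ x hx).1⟩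
      · intro a ha b hb hab
        by_contra hne
        exact Set.disjoint_left.1 (hdisj ha hb hne) (hσ a ha).1.1.1 (hab ▸ (hσ b hb).1.1.1)
      · rintro z ⟨hz, hzW⟩
        obtain ⟨x, hx, hzx⟩ := Set.mem_iUnion₂.1 hzW
        exact ⟨x, hx, hinj x (hσ x hx).1 hzx ((hσ x hx).2.trans hz.symm)⟩
      · intro x hx
        exact (hσ x hx).1.2.symm
    rw [h2, pushforwardFun]
    refine finsum_mem_inter_support_eq _ _ _ ?_
    ext z
    constructor
    · rintro ⟨hz, hzs⟩
      refine ⟨⟨hz, ?_⟩, hzs⟩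
      by_contra hzW
      exact hy'.2 ⟨z, ⟨subset_tsupport _ hzs, hzW⟩, hz⟩
    · rintro ⟨⟨hz, -⟩, hzs⟩
      exact ⟨hz, hzs⟩
  filter_upwards [hVo.mem_nhds hyV] with y' hy'
  rw [key y' hy', key y hyV]

theorem pushforwardFun_hasCompactSupport {X Y : Type*} [TopologicalSpace X] [TopologicalSpace Y]
    [T2Space Y] {π : X → Y} (hπ : IsLocalHomeomorph π) (f : C_c(X, ℤ)) :
    HasCompactSupport (pushforwardFun π f) := by
  refine HasCompactSupport.intro (K := π '' tsupport f)
    (IsCompact.image f.hasCompactSupport hπ.continuous) fun y hy => ?_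
  refine finsum_mem_eq_zero_of_forall_eq_zero fun x hx => ?_
  by_contra h
  exact hy ⟨x, subset_tsupport _ h, hx⟩

/-- The homomorphism `π_* : C_c(X, ℤ) → C_c(Y, ℤ)` induced by an étale map `π`. -/
noncomputable def pushforward {X Y : Type*} [TopologicalSpace X] [TopologicalSpace Y]
    [T2Space X] [T2Space Y] (π : X → Y) (hπ : IsLocalHomeomorph π) : C_c(X, ℤ) →+ C_c(Y, ℤ) :=
  AddMonoidHom.mk'
    (fun f =>
      { toFun := pushforwardFun π f
        continuous_toFun := pushforwardFun_continuous hπ f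
        hasCompactSupport' := pushforwardFun_hasCompactSupport hπ f })
    (by
      intro f g
      have hfin : ∀ (h : C_c(X, ℤ)) (y : Y), (π ⁻¹' {y} ∩ Function.support h).Finite := fun h y =>
        (finite_fiber_inter_isCompact hπ h.hasCompactSupport y).subset
          (Set.inter_subset_inter_right _ (subset_tsupport _))
      ext y
      exact finsum_mem_add_distrib' (hfin f y) (hfin g y))

/-! ### Étale groupoids -/

/-- An étale groupoid with space of arrows `G` and unit space `X`: a locally compact Hausdorff
topological groupoid whose range map is a local homeomorphism. The unit space is identified with
a subspace of `G` through `unit`, which is a topological embedding (`isEmbedding_unit` below).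
The product `g h` is defined exactly when `s g = r h`. -/
structure EtaleGroupoid (X G : Type*) [TopologicalSpace X] [TopologicalSpace G] where
  /-- the range map -/
  r : G → X
  /-- the source map -/
  s : G → X
  /-- the inclusion of the unit space -/
  unit : X → G
  /-- the product of a composable pair -/
  mul : (g h : G) → s g = r h → G
  /-- the inverse -/
  inv : G → G
  r_unit : ∀ x, r (unit x) = x
  s_unit : ∀ x, s (unit x) = x
  r_mul : ∀ g h hgh, r (mul g h hgh) = r g
  s_mul : ∀ g h hgh, s (mul g h hgh) = s h
  r_inv : ∀ g, r (inv g) = s g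
  s_inv : ∀ g, s (inv g) = r g
  mul_assoc : ∀ g h k (hgh : s g = r h) (hhk : s h = r k),
    mul (mul g h hgh) k ((s_mul g h hgh).trans hhk) =
      mul g (mul h k hhk) (hgh.trans (r_mul h k hhk).symm)
  unit_mul : ∀ g, mul (unit (r g)) g (s_unit (r g)) = g
  mul_unit : ∀ g, mul g (unit (s g)) (r_unit (s g)).symm = g
  inv_mul : ∀ g, mul (inv g) g (s_inv g) = unit (s g)
  mul_inv : ∀ g, mul g (inv g) (r_inv g).symm = unit (r g)
  continuous_unit : Continuous unit
  continuous_inv : Continuous inv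
  continuous_mul : Continuous fun p : {p : G × G // s p.1 = r p.2} => mul p.1.1 p.1.2 p.2
  t2Space : T2Space G
  locallyCompactSpace : LocallyCompactSpace G
  isLocalHomeomorph_r : IsLocalHomeomorph r

namespace EtaleGroupoid

variable {X G : Type*} [TopologicalSpace X] [TopologicalSpace G] (𝒢 : EtaleGroupoid X G)

theorem inv_inv (g : G) : 𝒢.inv (𝒢.inv g) = g := by
  have mul_congr : ∀ (a b c d : G) (h : 𝒢.s a = 𝒢.r b) (h' : 𝒢.s c = 𝒢.r d),
      a = c → b = d → 𝒢.mul a b h = 𝒢.mul c d h' := by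
    rintro a b _ _ h h' rfl rfl
    rfl
  have e1 : 𝒢.s (𝒢.inv (𝒢.inv g)) = 𝒢.r (𝒢.inv g) := 𝒢.s_inv _
  calc 𝒢.inv (𝒢.inv g)
      = 𝒢.mul (𝒢.inv (𝒢.inv g)) (𝒢.unit (𝒢.s (𝒢.inv (𝒢.inv g)))) (𝒢.r_unit _).symm :=
        (𝒢.mul_unit _).symm
    _ = 𝒢.mul (𝒢.inv (𝒢.inv g)) (𝒢.mul (𝒢.inv g) g (𝒢.s_inv g))
          (e1.trans (𝒢.r_mul _ _ _).symm) :=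
        mul_congr _ _ _ _ _ _ rfl (by rw [𝒢.inv_mul, e1, 𝒢.r_inv])
    _ = 𝒢.mul (𝒢.mul (𝒢.inv (𝒢.inv g)) (𝒢.inv g) e1) g ((𝒢.s_mul _ _ _).trans (𝒢.s_inv g)) :=
        (𝒢.mul_assoc _ _ _ _ _).symm
    _ = 𝒢.mul (𝒢.unit (𝒢.r g)) g (𝒢.s_unit _) :=
        mul_congr _ _ _ _ _ _ (by rw [𝒢.inv_mul, 𝒢.s_inv]) rfl
    _ = g := 𝒢.unit_mul g

theorem isLocalHomeomorph_s : IsLocalHomeomorph 𝒢.s := by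
  let e : G ≃ₜ G :=
    { toFun := 𝒢.inv
      invFun := 𝒢.inv
      left_inv := 𝒢.inv_inv
      right_inv := 𝒢.inv_inv
      continuous_toFun := 𝒢.continuous_inv
      continuous_invFun := 𝒢.continuous_inv }
  have h : 𝒢.s = 𝒢.r ∘ e := funext fun g => (𝒢.r_inv g).symm
  rw [h]
  exact 𝒢.isLocalHomeomorph_r.comp e.isLocalHomeomorph

theorem isEmbedding_unit : Topology.IsEmbedding 𝒢.unit :=
  Topology.IsEmbedding.of_leftInverse (f := 𝒢.r) 𝒢.r_unit 𝒢.isLocalHomeomorph_r.continuous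
    𝒢.continuous_unit

theorem t2Space_unitSpace (𝒢 : EtaleGroupoid X G) : T2Space X :=
  haveI := 𝒢.t2Space
  𝒢.isEmbedding_unit.t2Space

/-- The orbit `G(x) = r(Gx)` of a unit `x`. -/
def orbit (x : X) : Set X := 𝒢.r '' {g | 𝒢.s g = x}

/-- `G` is minimal if every orbit is dense in the unit space. -/
def IsMinimal : Prop := ∀ x : X, Dense (𝒢.orbit x)

/-- An elementary subgroupoid: a compact open principal subgroupoid containing all units. -/
structure IsElementary (K : Set G) : Prop where
  unit_mem : ∀ x, 𝒢.unit x ∈ K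
  mul_mem : ∀ g h hgh, g ∈ K → h ∈ K → 𝒢.mul g h hgh ∈ K
  inv_mem : ∀ g, g ∈ K → 𝒢.inv g ∈ K
  isCompact : IsCompact K
  isOpen : IsOpen K
  principal : ∀ g ∈ K, 𝒢.r g = 𝒢.s g → g ∈ Set.range 𝒢.unit

/-- `Kx`, the set of all elements of `K` with source `x`. -/
def sourceFiber (K : Set G) (x : X) : Set G := {k | k ∈ K ∧ 𝒢.s k = x}

/-- `C · A`, the set of all products of composable pairs from `C × A`. -/
def setMul (C A : Set G) : Set G := {g | ∃ c ∈ C, ∃ a ∈ A, ∃ h : 𝒢.s c = 𝒢.r a, 𝒢.mul c a h = g}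

/-- `G` is almost finite: for all compact `C ⊆ G` and `ε > 0` there is an elementary subgroupoid
`K` with `|CKx \ Kx| / |K(x)| < ε` for every unit `x`, where `K(x) = r(Kx)` is the `K`-orbit of
`x`. Both sets are finite (`finite_setMul_sourceFiber`, `finite_sourceFiber` below), so that
`Set.ncard` is the true cardinality. -/
def IsAlmostFinite : Prop :=
  ∀ C : Set G, IsCompact C → ∀ ε : ℝ, 0 < ε →
    ∃ K : Set G, 𝒢.IsElementary K ∧ ∀ x : X,
      ((𝒢.setMul C (𝒢.sourceFiber K x) \ 𝒢.sourceFiber K x).ncard : ℝ) /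
        ((𝒢.r '' 𝒢.sourceFiber K x).ncard : ℝ) < ε

theorem finite_sourceFiber {K : Set G} (hK : IsCompact K) (x : X) :
    (𝒢.sourceFiber K x).Finite := by
  have := 𝒢.t2Space_unitSpace
  exact (finite_fiber_inter_isCompact 𝒢.isLocalHomeomorph_s hK x).subset fun g hg => ⟨hg.2, hg.1⟩

theorem finite_setMul_sourceFiber {C K : Set G} (hC : IsCompact C) (hK : IsCompact K) (x : X) :
    (𝒢.setMul C (𝒢.sourceFiber K x)).Finite := by
  have h : (⋃ k ∈ 𝒢.sourceFiber K x, ⋃ c ∈ 𝒢.sourceFiber C (𝒢.r k),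
      {g | ∃ h : 𝒢.s c = 𝒢.r k, 𝒢.mul c k h = g}).Finite := by
    refine (𝒢.finite_sourceFiber hK x).biUnion fun k _ =>
      (𝒢.finite_sourceFiber hC (𝒢.r k)).biUnion fun c _ => Set.Subsingleton.finite ?_
    rintro _ ⟨_, rfl⟩ _ ⟨_, rfl⟩
    rfl
  refine h.subset ?_
  rintro g ⟨c, hc, k, hk, h, rfl⟩
  exact Set.mem_biUnion hk (Set.mem_biUnion (show c ∈ 𝒢.sourceFiber C (𝒢.r k) from ⟨hc, h⟩) ⟨h, rfl⟩)

/-! ### The homology group in degree zero -/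

/-- The boundary map `δ₁ = s_* - r_* : C_c(G, ℤ) → C_c(G⁽⁰⁾, ℤ)`. -/
noncomputable def boundary₁ : C_c(G, ℤ) →+ C_c(X, ℤ) :=
  haveI := 𝒢.t2Space
  haveI := 𝒢.t2Space_unitSpace
  pushforward 𝒢.s 𝒢.isLocalHomeomorph_s - pushforward 𝒢.r 𝒢.isLocalHomeomorph_r

/-- `H₀(G) = C_c(G⁽⁰⁾, ℤ) / Im δ₁` (the boundary map `δ₀` is zero). -/
abbrev H0 : Type _ := C_c(X, ℤ) ⧸ 𝒢.boundary₁.range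

/-- `H₀(G)⁺`, the set of classes of non-negative functions. -/
def H0Pos : Set 𝒢.H0 :=
  {a | ∃ f : C_c(X, ℤ), (∀ u, 0 ≤ f u) ∧ (QuotientAddGroup.mk f : 𝒢.H0) = a}

end EtaleGroupoid

/-! ### Ordered abelian groups, given by a positive cone

For a subset `P` of an abelian group, `x ≤ y` means `y - x ∈ P`. -/

/-- `(A, P)` is an ordered abelian group:
`P + P ⊆ P`, `P ∩ (-P) = {0}` and `P - P = A`. -/
structure IsOrderedAbelianGroup {A : Type*} [AddCommGroup A] (P : Set A) : Prop where
  add_mem : ∀ x ∈ P, ∀ y ∈ P, x + y ∈ P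
  mem_and_neg_mem_iff : ∀ x, (x ∈ P ∧ -x ∈ P) ↔ x = 0
  exists_sub : ∀ x, ∃ y ∈ P, ∃ z ∈ P, x = y - z

/-- The relation `x ≤ y` for the positive cone `P`. -/
def ConeLE {A : Type*} [AddCommGroup A] (P : Set A) (x y : A) : Prop := y - x ∈ P

/-- The relation `x < y` for the positive cone `P`. -/
def ConeLT {A : Type*} [AddCommGroup A] (P : Set A) (x y : A) : Prop := ConeLE P x y ∧ x ≠ y

/-- `u` is an order unit: `u ≥ 0`, and every `x` satisfies `-nu ≤ x ≤ nu` for some `n`. -/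
def IsOrderUnit {A : Type*} [AddCommGroup A] (P : Set A) (u : A) : Prop :=
  ConeLE P 0 u ∧ ∀ x : A, ∃ n : ℕ, ConeLE P (-(n • u)) x ∧ ConeLE P x (n • u)

/-- An ordered abelian group is simple if every non-zero positive element is an order unit. -/
def IsSimpleOrdered {A : Type*} [AddCommGroup A] (P : Set A) : Prop :=
  ∀ u : A, ConeLT P 0 u → IsOrderUnit P u

/-- Weakly unperforated: `nx > 0` for some `n ≥ 1` implies `x > 0`. -/
def IsWeaklyUnperforated {A : Type*} [AddCommGroup A] (P : Set A) : Prop :=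
  ∀ (x : A) (n : ℕ), 0 < n → ConeLT P 0 (n • x) → ConeLT P 0 x

/-- The Riesz interpolation property: if `xᵢ ≤ yⱼ` for `i, j ∈ {1, 2}`, there is `z` with
`xᵢ ≤ z ≤ yⱼ` for `i, j ∈ {1, 2}`. -/
def HasRieszInterpolation {A : Type*} [AddCommGroup A] (P : Set A) : Prop :=
  ∀ x y : Fin 2 → A, (∀ i j, ConeLE P (x i) (y j)) →
    ∃ z : A, (∀ i, ConeLE P (x i) z) ∧ ∀ j, ConeLE P z (y j)

/-!
# The ordered group `H₀(G)` of a minimal almost finite groupoid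

For an elementary subgroupoid `K` and `f ∈ C(X, ℤ)` consider the orbit sums
`f_K(x) = ∑_{y ∈ K(x)} f(y)`. Two facts relate them to the class of `f` in `H₀(G)`.

* A single `K` can witness positivity. `K` is finite over each unit and principal, so it has a
  clopen transversal `D` (`IsElementary.exists_transversal`), and pushing each orbit onto its point
  of `D` shows that `f` is homologous to `1_D f_K` (`IsElementary.exists_mk_eq`). Thus `f_K ≥ 0`
  implies `[f] ≥ 0`.
* Positivity is seen by all sufficiently invariant `K`. The orbit sums of a boundary `δ₁ φ` cancel
  up to a contribution of the arrows of the support of `φ` that have exactly one end in the orbit,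
  so they are `o(|K(x)|)` (`eventually_abs_orbitSum_boundary₁_le`). If `f ≥ 0` is non-zero,
  minimality and compactness of the unit space give `f_K(x) ≥ δ |K(x)|` for some `δ > 0`
  (`IsMinimal.exists_eventually_le_orbitSum`). Hence every class `[f] > 0` satisfies
  `f_K(x) ≥ δ |K(x)|` with some `δ > 0` (`IsMinimal.exists_eventually_le_orbitSum_of_mem`).

"Sufficiently invariant" is expressed by the filter `folner` on sets of arrows; almost finiteness
says that it is non-trivial, so finitely many eventual properties hold for a common `K`. The order
properties are then those of integer-valued functions. For instance, when all the inequalities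
`aᵢ ≤ bⱼ` are strict, some `K` makes the representatives `1_D (fᵢ)_K` lie pointwise below the
`1_D (gⱼ)_K`, and the pointwise maximum of the former interpolates. No invariant measures
are needed.
-/

namespace EtaleGroupoid

variable {X G : Type*} [TopologicalSpace X] [TopologicalSpace G] (𝒢 : EtaleGroupoid X G)

/-! ### Division of arrows with the same source -/

open Classical in
/-- The quotient `h k⁻¹` of two arrows with the same source. As a total function it takes the junk
value `h` when the sources differ. -/
noncomputable def div (h k : G) : G :=
  if H : 𝒢.s h = 𝒢.s k then 𝒢.mul h (𝒢.inv k) (H.trans (𝒢.r_inv k).symm) else h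

theorem mul_congr {a b c d : G} (h : 𝒢.s a = 𝒢.r b) (h' : 𝒢.s c = 𝒢.r d) (hac : a = c)
    (hbd : b = d) : 𝒢.mul a b h = 𝒢.mul c d h' := by
  subst hac hbd
  rfl

variable {h k : G}

theorem div_eq (H : 𝒢.s h = 𝒢.s k) :
    𝒢.div h k = 𝒢.mul h (𝒢.inv k) (H.trans (𝒢.r_inv k).symm) := dif_pos H

theorem r_div (H : 𝒢.s h = 𝒢.s k) : 𝒢.r (𝒢.div h k) = 𝒢.r h := by
  rw [𝒢.div_eq H, 𝒢.r_mul]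

theorem s_div (H : 𝒢.s h = 𝒢.s k) : 𝒢.s (𝒢.div h k) = 𝒢.r k := by
  rw [𝒢.div_eq H, 𝒢.s_mul, 𝒢.s_inv]

theorem div_mul_cancel (H : 𝒢.s h = 𝒢.s k) : 𝒢.mul (𝒢.div h k) k (𝒢.s_div H) = h := by
  have e : 𝒢.s h = 𝒢.r (𝒢.inv k) := H.trans (𝒢.r_inv k).symm
  calc 𝒢.mul (𝒢.div h k) k (𝒢.s_div H)
      = 𝒢.mul (𝒢.mul h (𝒢.inv k) e) k ((𝒢.s_mul _ _ _).trans (𝒢.s_inv k)) :=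
        𝒢.mul_congr _ _ (𝒢.div_eq H) rfl
    _ = 𝒢.mul h (𝒢.mul (𝒢.inv k) k (𝒢.s_inv k)) (e.trans (𝒢.r_mul _ _ _).symm) :=
        𝒢.mul_assoc _ _ _ _ _
    _ = 𝒢.mul h (𝒢.unit (𝒢.s h)) (𝒢.r_unit _).symm :=
        𝒢.mul_congr _ _ rfl (by rw [𝒢.inv_mul, H])
    _ = h := 𝒢.mul_unit h

theorem mul_div_cancel {g k : G} (H : 𝒢.s g = 𝒢.r k) : 𝒢.div (𝒢.mul g k H) k = g := by
  rw [𝒢.div_eq (𝒢.s_mul g k H), 𝒢.mul_assoc _ _ _ H (𝒢.r_inv k).symm]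
  calc _ = 𝒢.mul g (𝒢.unit (𝒢.s g)) (𝒢.r_unit _).symm :=
        𝒢.mul_congr _ _ rfl (by rw [𝒢.mul_inv, H])
    _ = g := 𝒢.mul_unit g

theorem inv_mul_cancel_left {g k : G} (H : 𝒢.s g = 𝒢.r k) :
    𝒢.mul (𝒢.inv g) (𝒢.mul g k H) ((𝒢.s_inv g).trans (𝒢.r_mul g k H).symm) = k := by
  rw [← 𝒢.mul_assoc _ _ _ (𝒢.s_inv g) H]
  calc _ = 𝒢.mul (𝒢.unit (𝒢.r k)) k (𝒢.s_unit _) :=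
        𝒢.mul_congr _ _ (by rw [𝒢.inv_mul, H]) rfl
    _ = k := 𝒢.unit_mul k

theorem inv_div (H : 𝒢.s h = 𝒢.s k) : 𝒢.inv (𝒢.div h k) = 𝒢.div k h := by
  have e : 𝒢.s (𝒢.inv (𝒢.div h k)) = 𝒢.r h := by rw [𝒢.s_inv, 𝒢.r_div H]
  have : 𝒢.mul (𝒢.inv (𝒢.div h k)) h e = k := by
    rw [𝒢.mul_congr e ((𝒢.s_inv _).trans (𝒢.r_mul _ _ _).symm) rfl (𝒢.div_mul_cancel H).symm,
      𝒢.inv_mul_cancel_left]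
  rw [← 𝒢.mul_div_cancel e, this]

theorem eq_of_div_mem_range_unit (H : 𝒢.s h = 𝒢.s k) (hu : 𝒢.div h k ∈ Set.range 𝒢.unit) :
    h = k := by
  obtain ⟨x, hx⟩ := hu
  have hxk : x = 𝒢.r k := by rw [← 𝒢.s_div H, ← hx, 𝒢.s_unit]
  rw [← 𝒢.div_mul_cancel H, 𝒢.mul_congr _ (𝒢.s_unit (𝒢.r k)) (by rw [← hx, hxk]) rfl,
    𝒢.unit_mul]

theorem eq_of_div_eq_div {k' : G} (H : 𝒢.s h = 𝒢.s k) (H' : 𝒢.s h = 𝒢.s k')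
    (e : 𝒢.div h k = 𝒢.div h k') : k = k' := by
  rw [← 𝒢.inv_mul_cancel_left (𝒢.s_div H), ← 𝒢.inv_mul_cancel_left (𝒢.s_div H')]
  exact 𝒢.mul_congr _ _ (by rw [e]) (by rw [𝒢.div_mul_cancel H, 𝒢.div_mul_cancel H'])

theorem mem_setMul_of_div_mem {C A : Set G} (H : 𝒢.s h = 𝒢.s k) (hk : k ∈ A)
    (hC : 𝒢.div h k ∈ C) : h ∈ 𝒢.setMul C A :=
  ⟨_, hC, k, hk, 𝒢.s_div H, 𝒢.div_mul_cancel H⟩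

theorem bijOn_div_right {x : X} (hk : 𝒢.s k = x) :
    Set.BijOn (fun h => 𝒢.div h k) (𝒢.s ⁻¹' {x}) (𝒢.s ⁻¹' {𝒢.r k}) := by
  refine ⟨fun h hh => 𝒢.s_div (Eq.trans hh hk.symm), fun h hh h' hh' e => ?_, fun g hg => ?_⟩
  · rw [← 𝒢.div_mul_cancel (Eq.trans hh hk.symm), ← 𝒢.div_mul_cancel (Eq.trans hh' hk.symm)]
    exact 𝒢.mul_congr _ _ e rfl
  · exact ⟨𝒢.mul g k hg, (𝒢.s_mul _ _ _).trans hk, 𝒢.mul_div_cancel hg⟩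

theorem bijOn_div_left {x : X} (hk : 𝒢.s k = x) :
    Set.BijOn (fun h => 𝒢.div k h) (𝒢.s ⁻¹' {x}) (𝒢.r ⁻¹' {𝒢.r k}) := by
  refine ⟨fun h hh => 𝒢.r_div (Eq.trans hk (Eq.symm hh)), fun h hh h' hh' e => ?_,
    fun g hg => ?_⟩
  · exact 𝒢.eq_of_div_eq_div (hk.trans (Eq.symm hh)) (hk.trans (Eq.symm hh')) e
  · have e : 𝒢.s (𝒢.inv g) = 𝒢.r k := (𝒢.s_inv g).trans hg
    refine ⟨𝒢.mul (𝒢.inv g) k e, (𝒢.s_mul _ _ _).trans hk, ?_⟩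
    change 𝒢.div k _ = g
    rw [← 𝒢.inv_div (𝒢.s_mul _ _ _), 𝒢.mul_div_cancel, 𝒢.inv_inv]

variable {𝒢} {K : Set G}

theorem IsElementary.div_mem (hK : 𝒢.IsElementary K) (hh : h ∈ K) (hk : k ∈ K)
    (H : 𝒢.s h = 𝒢.s k) : 𝒢.div h k ∈ K := by
  rw [𝒢.div_eq H]
  exact hK.mul_mem _ _ _ hh (hK.inv_mem _ hk)

theorem IsElementary.injOn_r (hK : 𝒢.IsElementary K) (x : X) :
    Set.InjOn 𝒢.r (𝒢.sourceFiber K x) := by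
  intro h hh k hk e
  have H : 𝒢.s h = 𝒢.s k := hh.2.trans hk.2.symm
  exact 𝒢.eq_of_div_mem_range_unit H (hK.principal _ (hK.div_mem hh.1 hk.1 H)
    (by rw [𝒢.r_div H, 𝒢.s_div H, e]))

theorem IsElementary.ncard_orbit (hK : 𝒢.IsElementary K) (x : X) :
    (𝒢.r '' 𝒢.sourceFiber K x).ncard = (𝒢.sourceFiber K x).ncard :=
  (hK.injOn_r x).ncard_image

theorem IsElementary.unit_mem_sourceFiber (hK : 𝒢.IsElementary K) (x : X) :
    𝒢.unit x ∈ 𝒢.sourceFiber K x := ⟨hK.unit_mem x, 𝒢.s_unit x⟩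

theorem IsElementary.ncard_sourceFiber_pos (hK : 𝒢.IsElementary K) (x : X) :
    0 < (𝒢.sourceFiber K x).ncard :=
  (Set.ncard_pos (𝒢.finite_sourceFiber hK.isCompact x)).2 ⟨_, hK.unit_mem_sourceFiber x⟩

/-! ### The Følner filter -/

variable (𝒢)

/-- The filter of sufficiently invariant elementary subgroupoids: a property holds eventually
along it if, for some compact `C` and some `ε > 0`, it holds for all elementary subgroupoids `K`
with `|CKx \ Kx| < ε |K(x)|` for every unit `x`. -/
def folner : Filter (Set G) where
  sets := {P | ∃ C : Set G, IsCompact C ∧ ∃ ε : ℝ, 0 < ε ∧ ∀ K : Set G, 𝒢.IsElementary K →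
    (∀ x : X, ((𝒢.setMul C (𝒢.sourceFiber K x) \ 𝒢.sourceFiber K x).ncard : ℝ) /
        ((𝒢.r '' 𝒢.sourceFiber K x).ncard : ℝ) < ε) → K ∈ P}
  univ_sets := ⟨∅, isCompact_empty, 1, one_pos, fun _ _ _ => trivial⟩
  sets_of_superset := by
    rintro P Q ⟨C, hC, ε, hε, H⟩ hPQ
    exact ⟨C, hC, ε, hε, fun K hK h => hPQ (H K hK h)⟩
  inter_sets := by
    rintro P Q ⟨C, hC, ε, hε, H⟩ ⟨C', hC', ε', hε', H'⟩
    refine ⟨C ∪ C', hC.union hC', min ε ε', lt_min hε hε', fun K hK h => ⟨H K hK fun x => ?_,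
      H' K hK fun x => ?_⟩⟩
    all_goals
      refine lt_of_le_of_lt ?_ (lt_of_lt_of_le (h x) (by simp))
      gcongr
      · exact (𝒢.finite_setMul_sourceFiber (hC.union hC') hK.isCompact x).sdiff
      · rintro g ⟨c, hc, a, ha, e, rfl⟩
        exact ⟨c, by simp [hc], a, ha, e, rfl⟩

variable {𝒢}

theorem IsAlmostFinite.neBot_folner (h : 𝒢.IsAlmostFinite) : 𝒢.folner.NeBot := by
  rw [← Filter.empty_mem_iff_bot.not.trans Filter.neBot_iff.symm]
  rintro ⟨C, hC, ε, hε, H⟩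
  obtain ⟨K, hK, hKC⟩ := h C hC ε hε
  exact H K hK hKC

theorem eventually_isElementary : ∀ᶠ K in 𝒢.folner, 𝒢.IsElementary K :=
  ⟨∅, isCompact_empty, 1, one_pos, fun _ hK _ => hK⟩

theorem eventually_ncard_setMul_diff_le {C : Set G} (hC : IsCompact C) {ε : ℝ} (hε : 0 < ε) :
    ∀ᶠ K in 𝒢.folner, ∀ x : X,
      ((𝒢.setMul C (𝒢.sourceFiber K x) \ 𝒢.sourceFiber K x).ncard : ℝ) ≤
        ε * (𝒢.sourceFiber K x).ncard := by
  refine ⟨C, hC, ε, hε, fun K hK h x => ?_⟩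
  have h1 := h x
  rw [hK.ncard_orbit] at h1
  exact ((div_lt_iff₀ (by exact_mod_cast hK.ncard_sourceFiber_pos x)).1 h1).le

/-! ### Fibres of compact sets -/

theorem exists_encard_fiber_le {Z Y : Type*} [TopologicalSpace Z] [TopologicalSpace Y]
    {π : Z → Y} (hπ : IsLocalHomeomorph π) {C : Set Z} (hC : IsCompact C) :
    ∃ N : ℕ, ∀ y, (C ∩ π ⁻¹' {y}).encard ≤ N := by
  refine hC.induction_on (p := fun C => ∃ N : ℕ, ∀ y, (C ∩ π ⁻¹' {y}).encard ≤ N)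
    ⟨0, by simp⟩ ?_ ?_ ?_
  · rintro s t hst ⟨N, hN⟩
    exact ⟨N, fun y => (Set.encard_le_encard (Set.inter_subset_inter_left _ hst)).trans (hN y)⟩
  · rintro s t ⟨N, hN⟩ ⟨M, hM⟩
    refine ⟨N + M, fun y => ?_⟩
    rw [Set.union_inter_distrib_right]
    exact (Set.encard_union_le _ _).trans (by push_cast; exact add_le_add (hN y) (hM y))
  · intro z _
    obtain ⟨e, hze, rfl⟩ := hπ z
    refine ⟨e.source, mem_nhdsWithin_of_mem_nhds (e.open_source.mem_nhds hze), 1, fun y => ?_⟩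
    rw [Nat.cast_one, Set.encard_le_one_iff]
    exact fun a b ha hb => e.injOn ha.1 hb.1 (Eq.trans ha.2 (Eq.symm hb.2))

/-- For compact `C`, the number of ways to write `h = c k` with `c ∈ C` is bounded uniformly in `h`:
`k` is determined by `c`, which lies in the fibre of `C` over `r h`. -/
theorem exists_card_filter_div_mem_le (𝒢 : EtaleGroupoid X G) {C : Set G} (hC : IsCompact C)
    [DecidablePred (· ∈ C)] :
    ∃ N : ℕ, 0 < N ∧ ∀ (F : Finset G) (h : G), (∀ k ∈ F, 𝒢.s h = 𝒢.s k) →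
      (F.filter fun k => 𝒢.div h k ∈ C).card ≤ N := by
  obtain ⟨N, hN⟩ := exists_encard_fiber_le 𝒢.isLocalHomeomorph_r hC
  refine ⟨N + 1, N.succ_pos, fun F h hF => le_trans ?_ N.le_succ⟩
  rw [← Nat.cast_le (α := ℕ∞), ← Set.encard_coe_eq_coe_finsetCard]
  refine (Set.encard_le_encard_of_injOn (t := C ∩ 𝒢.r ⁻¹' {𝒢.r h})
    (f := fun k => 𝒢.div h k) ?_ ?_).trans (hN (𝒢.r h))
  · intro k hk
    simp only [Finset.coe_filter, Set.mem_ofPred_eq] at hk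
    exact ⟨hk.2, 𝒢.r_div (hF k hk.1)⟩
  · intro k hk k' hk' e
    simp only [Finset.coe_filter, Set.mem_ofPred_eq] at hk hk'
    exact 𝒢.eq_of_div_eq_div (hF k hk.1) (hF k' hk'.1) e

/-! ### Sums over orbits -/

variable (𝒢)

/-- The sum `∑_{y ∈ K(x)} f(y)` of `f` over the `K`-orbit of `x`, indexed by `Kx`, which `r` maps
bijectively onto `K(x)` when `K` is principal. -/
noncomputable def orbitSum (K : Set G) (f : X → ℤ) (x : X) : ℤ :=
  ∑ᶠ k ∈ 𝒢.sourceFiber K x, f (𝒢.r k)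

variable {𝒢}

theorem IsElementary.orbitSum_eq (hK : 𝒢.IsElementary K) (f : X → ℤ) (x : X) :
    𝒢.orbitSum K f x = ∑ k ∈ (𝒢.finite_sourceFiber hK.isCompact x).toFinset, f (𝒢.r k) :=
  finsum_mem_eq_finite_toFinset_sum _ _

theorem IsElementary.orbitSum_add (hK : 𝒢.IsElementary K) (f g : X → ℤ) (x : X) :
    𝒢.orbitSum K (f + g) x = 𝒢.orbitSum K f x + 𝒢.orbitSum K g x := by
  simp only [hK.orbitSum_eq, Pi.add_apply, Finset.sum_add_distrib]

theorem IsElementary.orbitSum_sub (hK : 𝒢.IsElementary K) (f g : X → ℤ) (x : X) :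
    𝒢.orbitSum K (f - g) x = 𝒢.orbitSum K f x - 𝒢.orbitSum K g x := by
  simp only [hK.orbitSum_eq, Pi.sub_apply, Finset.sum_sub_distrib]

theorem IsElementary.orbitSum_nsmul (hK : 𝒢.IsElementary K) (n : ℕ) (f : X → ℤ) (x : X) :
    𝒢.orbitSum K (n • f) x = n * 𝒢.orbitSum K f x := by
  simp only [hK.orbitSum_eq, Pi.smul_apply, Finset.mul_sum, ← nsmul_eq_mul]

theorem IsElementary.abs_orbitSum_le (hK : 𝒢.IsElementary K) {f : X → ℤ} {M : ℝ}
    (hM : ∀ x, |(f x : ℝ)| ≤ M) (x : X) :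
    |(𝒢.orbitSum K f x : ℝ)| ≤ M * (𝒢.sourceFiber K x).ncard := by
  rw [hK.orbitSum_eq, Set.ncard_eq_toFinset_card _ (𝒢.finite_sourceFiber hK.isCompact x), mul_comm,
    ← nsmul_eq_mul]
  push_cast
  exact (Finset.abs_sum_le_sum_abs _ _).trans (Finset.sum_le_card_nsmul _ _ _ fun k _ => hM _)

end EtaleGroupoid

namespace EtaleGroupoid

variable {X G : Type*} [TopologicalSpace X] [TopologicalSpace G] {𝒢 : EtaleGroupoid X G}
  {K : Set G}

/-! ### Orbit sums of boundaries -/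

theorem finsum_fiber_s_eq {φ : G → ℤ} {x : X} {k : G} (hk : 𝒢.s k = x) {T : Finset G}
    (hTx : ∀ h ∈ T, 𝒢.s h = x) (hT : ∀ h, 𝒢.s h = x → φ (𝒢.div h k) ≠ 0 → h ∈ T) :
    ∑ᶠ g ∈ 𝒢.s ⁻¹' {𝒢.r k}, φ g = ∑ h ∈ T, φ (𝒢.div h k) := by
  rw [← finsum_mem_eq_of_bijOn _ (𝒢.bijOn_div_right hk) fun _ _ => rfl]
  refine finsum_mem_eq_sum_of_inter_support_eq _ ?_
  ext h
  exact ⟨fun H => ⟨hT h H.1 H.2, H.2⟩, fun H => ⟨hTx h H.1, H.2⟩⟩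

theorem finsum_fiber_r_eq {φ : G → ℤ} {x : X} {k : G} (hk : 𝒢.s k = x) {T : Finset G}
    (hTx : ∀ h ∈ T, 𝒢.s h = x) (hT : ∀ h, 𝒢.s h = x → φ (𝒢.div k h) ≠ 0 → h ∈ T) :
    ∑ᶠ g ∈ 𝒢.r ⁻¹' {𝒢.r k}, φ g = ∑ h ∈ T, φ (𝒢.div k h) := by
  rw [← finsum_mem_eq_of_bijOn _ (𝒢.bijOn_div_left hk) fun _ _ => rfl]
  refine finsum_mem_eq_sum_of_inter_support_eq _ ?_
  ext h
  exact ⟨fun H => ⟨hT h H.1 H.2, H.2⟩, fun H => ⟨hTx h H.1, H.2⟩⟩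

theorem boundary₁_apply (φ : C_c(G, ℤ)) (x : X) :
    𝒢.boundary₁ φ x = ∑ᶠ g ∈ 𝒢.s ⁻¹' {x}, φ g - ∑ᶠ g ∈ 𝒢.r ⁻¹' {x}, φ g := rfl

/-- Each arrow of `CKx \ Kx` arises as a product `c k` for at most `N` of the `k ∈ Kx`, and it
contributes at most `2 M` to the orbit sum of the boundary for each of them; everything else
cancels. -/
theorem IsElementary.abs_orbitSum_boundary₁_le (hK : 𝒢.IsElementary K) (φ : C_c(G, ℤ))
    {M : ℤ} (hM : ∀ g, |φ g| ≤ M) {C : Set G} (hC : IsCompact C)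
    (hφC : ∀ g, φ g ≠ 0 → g ∈ C ∧ 𝒢.inv g ∈ C) {N : ℕ} [DecidablePred (· ∈ C)]
    (hN : ∀ (F : Finset G) (h : G), (∀ k ∈ F, 𝒢.s h = 𝒢.s k) →
      (F.filter fun k => 𝒢.div h k ∈ C).card ≤ N) (x : X) :
    |𝒢.orbitSum K (𝒢.boundary₁ φ) x| ≤
      (𝒢.setMul C (𝒢.sourceFiber K x) \ 𝒢.sourceFiber K x).ncard * (N * (2 * M)) := by
  classical
  have hSf := 𝒢.finite_sourceFiber hK.isCompact x
  have hTf := (𝒢.finite_setMul_sourceFiber hC hK.isCompact x).sdiff (t := 𝒢.sourceFiber K x)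
  rw [Set.ncard_eq_toFinset_card _ hTf, hK.orbitSum_eq]
  set S := hSf.toFinset with hS
  set T := hTf.toFinset with hT
  have memS : ∀ {k}, k ∈ S ↔ k ∈ 𝒢.sourceFiber K x := hSf.mem_toFinset
  have memT : ∀ {h}, h ∈ T ↔ h ∈ 𝒢.setMul C (𝒢.sourceFiber K x) \ 𝒢.sourceFiber K x :=
    hTf.mem_toFinset
  have hSx : ∀ k ∈ S, 𝒢.s k = x := fun k hk => (memS.1 hk).2
  have hTx : ∀ h ∈ T, 𝒢.s h = x := by
    intro h hh
    obtain ⟨⟨c, -, a, ha, e, rfl⟩, -⟩ := memT.1 hh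
    rw [𝒢.s_mul, ha.2]
  have hdisj : Disjoint S T := Finset.disjoint_left.2 fun k hk hk' => (memT.1 hk').2 (memS.1 hk)
  have hSTx : ∀ h ∈ S ∪ T, 𝒢.s h = x := fun h hh =>
    (Finset.mem_union.1 hh).elim (hSx h) (hTx h)
  have hST : ∀ h k, 𝒢.s h = x → k ∈ S → 𝒢.div h k ∈ C → h ∈ S ∪ T := by
    intro h k hh hk hd
    by_cases hhS : h ∈ S
    · exact Finset.mem_union_left _ hhS
    · exact Finset.mem_union_right _ (memT.2
        ⟨𝒢.mem_setMul_of_div_mem (hh.trans (hSx k hk).symm) (memS.1 hk) hd,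
          fun h' => hhS (memS.2 h')⟩)
  have key : ∀ k ∈ S, 𝒢.boundary₁ φ (𝒢.r k) =
      ∑ h ∈ S, (φ (𝒢.div h k) - φ (𝒢.div k h)) + ∑ h ∈ T, (φ (𝒢.div h k) - φ (𝒢.div k h)) := by
    intro k hk
    rw [boundary₁_apply,
      finsum_fiber_s_eq (hSx k hk) hSTx fun h hh hne => hST h k hh hk (hφC _ hne).1,
      finsum_fiber_r_eq (hSx k hk) hSTx fun h hh hne => hST h k hh hk ?_,
      ← Finset.sum_sub_distrib, Finset.sum_union hdisj]
    rw [← 𝒢.inv_div ((hSx k hk).trans hh.symm)]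
    exact (hφC _ hne).2
  -- The contributions of pairs inside `Kx` cancel by symmetry.
  have hcancel : ∑ k ∈ S, ∑ h ∈ S, (φ (𝒢.div h k) - φ (𝒢.div k h)) = 0 := by
    simp only [Finset.sum_sub_distrib]
    rw [Finset.sum_comm, sub_self]
  rw [Finset.sum_congr rfl key, Finset.sum_add_distrib, hcancel, zero_add, Finset.sum_comm,
    ← nsmul_eq_mul]
  refine (Finset.abs_sum_le_sum_abs _ _).trans (Finset.sum_le_card_nsmul _ _ _ fun h hh => ?_)
  have hM0 : 0 ≤ M := (abs_nonneg _).trans (hM h)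
  have hsub : ∀ k ∈ S, 𝒢.div h k ∉ C → φ (𝒢.div h k) - φ (𝒢.div k h) = 0 := by
    intro k hk hd
    have h1 : φ (𝒢.div h k) = 0 := by
      by_contra hne
      exact hd (hφC _ hne).1
    have h2 : φ (𝒢.div k h) = 0 := by
      by_contra hne
      apply hd
      rw [← 𝒢.inv_div ((hSx k hk).trans (hTx h hh).symm)]
      exact (hφC _ hne).2
    rw [h1, h2, sub_zero]
  rw [← Finset.sum_filter_of_ne (p := fun k => 𝒢.div h k ∈ C) fun k hk hne => by
    by_contra hd
    exact hne (hsub k hk hd)]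
  refine (Finset.abs_sum_le_sum_abs _ _).trans ((Finset.sum_le_card_nsmul _ _ (2 * M) fun k _ =>
    ?_).trans ?_)
  · have h1 := hM (𝒢.div h k)
    have h2 := hM (𝒢.div k h)
    have h3 := abs_sub (φ (𝒢.div h k)) (φ (𝒢.div k h))
    linarith
  · rw [nsmul_eq_mul]
    have := hN S h fun k hk => (hTx h hh).trans (hSx k hk).symm
    gcongr

theorem exists_abs_le {Z : Type*} [TopologicalSpace Z] (f : C_c(Z, ℤ)) :
    ∃ M : ℕ, ∀ z, |f z| ≤ M := by
  obtain ⟨M, hM⟩ := f.hasCompactSupport.exists_bound_of_continuous f.continuous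
  refine ⟨⌈M⌉₊, fun z => ?_⟩
  have h := (hM z).trans (Nat.le_ceil M)
  rw [Int.norm_eq_abs] at h
  exact_mod_cast h

theorem eventually_abs_orbitSum_boundary₁_le (φ : C_c(G, ℤ)) {η : ℝ} (hη : 0 < η) :
    ∀ᶠ K in 𝒢.folner, ∀ x : X,
      |(𝒢.orbitSum K (𝒢.boundary₁ φ) x : ℝ)| ≤ η * (𝒢.sourceFiber K x).ncard := by
  classical
  obtain ⟨M, hM⟩ := exists_abs_le φ
  have hC : IsCompact (tsupport φ ∪ 𝒢.inv '' tsupport φ) :=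
    IsCompact.union φ.hasCompactSupport (IsCompact.image φ.hasCompactSupport 𝒢.continuous_inv)
  have hφC : ∀ g, φ g ≠ 0 → g ∈ tsupport φ ∪ 𝒢.inv '' tsupport φ ∧
      𝒢.inv g ∈ tsupport φ ∪ 𝒢.inv '' tsupport φ := fun g hg =>
    have hg' : g ∈ tsupport φ := subset_tsupport _ hg
    ⟨Or.inl hg', Or.inr ⟨g, hg', rfl⟩⟩
  obtain ⟨N, -, hN⟩ := exists_card_filter_div_mem_le 𝒢 hC
  have hpos : (0 : ℝ) < N * (2 * M) + 1 := by positivity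
  filter_upwards [eventually_isElementary, eventually_ncard_setMul_diff_le hC (div_pos hη hpos)]
    with K hK hinv x
  have h1 : |(𝒢.orbitSum K (𝒢.boundary₁ φ) x : ℝ)| ≤ (𝒢.setMul (tsupport φ ∪ 𝒢.inv '' tsupport φ)
      (𝒢.sourceFiber K x) \ 𝒢.sourceFiber K x).ncard * (N * (2 * M)) := by
    exact_mod_cast hK.abs_orbitSum_boundary₁_le φ hM hC hφC hN x
  refine h1.trans ?_
  calc _ ≤ (η / (N * (2 * M) + 1) * (𝒢.sourceFiber K x).ncard) * (N * (2 * M) + 1 : ℝ) := by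
        gcongr
        · exact hinv x
        · linarith
    _ = η * (𝒢.sourceFiber K x).ncard := by
        field_simp

/-! ### Positivity of orbit sums from minimality -/

theorem IsMinimal.exists_isCompact [CompactSpace X] (hmin : 𝒢.IsMinimal) {U : Set X}
    (hU : IsOpen U) (hne : U.Nonempty) :
    ∃ C : Set G, IsCompact C ∧ ∀ x, ∃ g ∈ C, 𝒢.s g = x ∧ 𝒢.r g ∈ U := by
  have := 𝒢.locallyCompactSpace
  suffices H : ∃ C : Set G, IsCompact C ∧ ∀ x ∈ Set.univ, ∃ g ∈ C, 𝒢.s g = x ∧ 𝒢.r g ∈ U by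
    simpa using H
  refine isCompact_univ.induction_on
    (p := fun S => ∃ C : Set G, IsCompact C ∧ ∀ x ∈ S, ∃ g ∈ C, 𝒢.s g = x ∧ 𝒢.r g ∈ U)
    ⟨∅, isCompact_empty, by simp⟩ ?_ ?_ ?_
  · rintro S T hST ⟨C, hC, H⟩
    exact ⟨C, hC, fun x hx => H x (hST hx)⟩
  · rintro S T ⟨C, hC, H⟩ ⟨C', hC', H'⟩
    refine ⟨C ∪ C', hC.union hC', ?_⟩
    rintro x (hx | hx)
    · obtain ⟨g, hg, h⟩ := H x hx
      exact ⟨g, Or.inl hg, h⟩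
    · obtain ⟨g, hg, h⟩ := H' x hx
      exact ⟨g, Or.inr hg, h⟩
  · intro x _
    obtain ⟨_, hyU, g, hg, rfl⟩ := (hmin x).inter_open_nonempty U hU hne
    obtain ⟨C, hCg, hCU, hC⟩ := local_compact_nhds
      ((hU.preimage 𝒢.isLocalHomeomorph_r.continuous).mem_nhds hyU)
    refine ⟨𝒢.s '' C, mem_nhdsWithin_of_mem_nhds ?_, C, hC, ?_⟩
    · rw [← show 𝒢.s g = x from hg]
      exact 𝒢.isLocalHomeomorph_s.isOpenMap.image_mem_nhds hCg
    · rintro _ ⟨c, hc, rfl⟩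
      exact ⟨c, hc, rfl, hCU hc⟩

/-- Choosing for every unit an arrow of `C` that moves it into `{f ≥ 1}` maps `Kx` into `CKx`, at most
`N` to one. The image consists of arrows outside `Kx` and of arrows of `Kx` with range in
`{f ≥ 1}`, and the orbit sum of `f` bounds the number of the latter. -/
theorem IsElementary.ncard_sourceFiber_le (hK : 𝒢.IsElementary K) {f : X → ℤ} (hf : ∀ x, 0 ≤ f x)
    {C : Set G} (hC : IsCompact C) (hCU : ∀ x, ∃ g ∈ C, 𝒢.s g = x ∧ 1 ≤ f (𝒢.r g))
    {N : ℕ} [DecidablePred (· ∈ C)]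
    (hN : ∀ (F : Finset G) (h : G), (∀ k ∈ F, 𝒢.s h = 𝒢.s k) →
      (F.filter fun k => 𝒢.div h k ∈ C).card ≤ N) (x : X) :
    ((𝒢.sourceFiber K x).ncard : ℤ) ≤ N *
      ((𝒢.setMul C (𝒢.sourceFiber K x) \ 𝒢.sourceFiber K x).ncard + 𝒢.orbitSum K f x) := by
  classical
  have hSf := 𝒢.finite_sourceFiber hK.isCompact x
  have hTf := (𝒢.finite_setMul_sourceFiber hC hK.isCompact x).sdiff (t := 𝒢.sourceFiber K x)
  rw [Set.ncard_eq_toFinset_card _ hTf, Set.ncard_eq_toFinset_card _ hSf, hK.orbitSum_eq]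
  set S := hSf.toFinset with hS
  set T := hTf.toFinset with hT
  have memS : ∀ {k}, k ∈ S ↔ k ∈ 𝒢.sourceFiber K x := hSf.mem_toFinset
  have memT : ∀ {h}, h ∈ T ↔ h ∈ 𝒢.setMul C (𝒢.sourceFiber K x) \ 𝒢.sourceFiber K x :=
    hTf.mem_toFinset
  choose γ hγC hγs hγf using hCU
  let m : G → G := fun k => 𝒢.mul (γ (𝒢.r k)) k (hγs _)
  have hdiv : ∀ k, 𝒢.div (m k) k = γ (𝒢.r k) := fun k => 𝒢.mul_div_cancel _
  have hms : ∀ k, 𝒢.s (m k) = 𝒢.s k := fun k => 𝒢.s_mul _ _ _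
  have h1 : S.card ≤ N * (S.image m).card := by
    refine Finset.card_le_mul_card_image S N fun h hh => ?_
    obtain ⟨k₀, hk₀, rfl⟩ := Finset.mem_image.1 hh
    refine (Finset.card_le_card fun k hk => ?_).trans
      (hN S (m k₀) fun k hk => (hms k₀).trans ((memS.1 hk₀).2.trans (memS.1 hk).2.symm))
    obtain ⟨hkS, hk⟩ := Finset.mem_filter.1 hk
    refine Finset.mem_filter.2 ⟨hkS, ?_⟩
    rw [← hk, hdiv]
    exact hγC _
  have h2 : S.image m ⊆ T ∪ S.filter fun k => 1 ≤ f (𝒢.r k) := by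
    intro h hh
    obtain ⟨k, hk, rfl⟩ := Finset.mem_image.1 hh
    by_cases hmk : m k ∈ S
    · refine Finset.mem_union_right _ (Finset.mem_filter.2 ⟨hmk, ?_⟩)
      rw [𝒢.r_mul]
      exact hγf _
    · exact Finset.mem_union_left _ (memT.2
        ⟨⟨_, hγC _, k, memS.1 hk, hγs _, rfl⟩, fun h => hmk (memS.2 h)⟩)
  have h3 : ((S.filter fun k => 1 ≤ f (𝒢.r k)).card : ℤ) ≤ ∑ k ∈ S, f (𝒢.r k) := by
    calc ((S.filter fun k => 1 ≤ f (𝒢.r k)).card : ℤ)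
        ≤ ∑ k ∈ S.filter fun k => 1 ≤ f (𝒢.r k), f (𝒢.r k) := by
          simpa using Finset.card_nsmul_le_sum (S.filter fun k => 1 ≤ f (𝒢.r k))
            (fun k => f (𝒢.r k)) 1 fun k hk => (Finset.mem_filter.1 hk).2
      _ ≤ _ := Finset.sum_le_sum_of_subset_of_nonneg (Finset.filter_subset _ _)
          fun _ _ _ => hf _
  have h4 : (S.image m).card ≤ T.card + (S.filter fun k => 1 ≤ f (𝒢.r k)).card :=
    (Finset.card_le_card h2).trans (Finset.card_union_le _ _)
  have h5 : ((S.image m).card : ℤ) ≤ T.card + ∑ k ∈ S, f (𝒢.r k) := by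
    have : ((S.image m).card : ℤ) ≤ T.card + (S.filter fun k => 1 ≤ f (𝒢.r k)).card := by
      exact_mod_cast h4
    linarith
  calc (S.card : ℤ) ≤ N * (S.image m).card := by exact_mod_cast h1
    _ ≤ _ := by gcongr

theorem IsMinimal.exists_eventually_le_orbitSum [CompactSpace X] (hmin : 𝒢.IsMinimal)
    {f : C_c(X, ℤ)} (hf : ∀ x, 0 ≤ f x) (hf0 : f ≠ 0) :
    ∃ δ : ℝ, 0 < δ ∧ ∀ᶠ K in 𝒢.folner, ∀ x : X,
      δ * (𝒢.sourceFiber K x).ncard ≤ 𝒢.orbitSum K f x := by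
  classical
  have hU : IsOpen (f ⁻¹' Set.Ici 1) := (isOpen_discrete _).preimage f.continuous
  have hne : (f ⁻¹' Set.Ici 1).Nonempty := by
    by_contra h
    refine hf0 (DFunLike.ext _ _ fun x => le_antisymm ?_ (hf x))
    by_contra hx
    exact h ⟨x, Int.add_one_le_iff.2 (not_le.1 hx)⟩
  obtain ⟨C, hC, hCU⟩ := hmin.exists_isCompact hU hne
  obtain ⟨N, hN0, hN⟩ := exists_card_filter_div_mem_le 𝒢 hC
  have hN' : (0 : ℝ) < N := by exact_mod_cast hN0
  refine ⟨1 / (2 * N), by positivity, ?_⟩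
  filter_upwards [eventually_isElementary,
    eventually_ncard_setMul_diff_le hC (ε := 1 / (2 * N)) (by positivity)] with K hK hinv x
  have h1 : ((𝒢.sourceFiber K x).ncard : ℝ) ≤ N *
      ((𝒢.setMul C (𝒢.sourceFiber K x) \ 𝒢.sourceFiber K x).ncard + 𝒢.orbitSum K f x) := by
    exact_mod_cast hK.ncard_sourceFiber_le hf hC hCU hN x
  have h2 : ((𝒢.sourceFiber K x).ncard : ℝ) ≤ N *
      (1 / (2 * N) * (𝒢.sourceFiber K x).ncard + 𝒢.orbitSum K f x) :=
    h1.trans (by gcongr; exact hinv x)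
  have h3 : (N : ℝ) * (1 / (2 * N) * (𝒢.sourceFiber K x).ncard + 𝒢.orbitSum K f x) =
      (𝒢.sourceFiber K x).ncard / 2 + N * 𝒢.orbitSum K f x := by
    field_simp
  rw [one_div, inv_mul_le_iff₀ (by positivity)]
  linarith

/-! ### Clopen transversals of elementary subgroupoids -/

theorem isOpen_range_unit (𝒢 : EtaleGroupoid X G) : IsOpen (Set.range 𝒢.unit) := by
  have h : IsLocalHomeomorph (𝒢.r ∘ 𝒢.unit) := by
    rw [show 𝒢.r ∘ 𝒢.unit = id from funext 𝒢.r_unit]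
    exact (Homeomorph.refl X).isLocalHomeomorph
  exact (h.of_comp 𝒢.isLocalHomeomorph_r 𝒢.continuous_unit).isOpenMap.isOpen_range

theorem IsElementary.isClopen (hK : 𝒢.IsElementary K) : IsClopen K :=
  haveI := 𝒢.t2Space
  ⟨hK.isCompact.isClosed, hK.isOpen⟩

/-- Every unit has a clopen neighbourhood meeting each `K`-orbit at most once: the pairs
`(r k, s k)` of non-units `k ∈ K` form a compact set that misses the diagonal, since the non-units
of `K` are compact and `K` is principal. -/
theorem IsElementary.exists_isClopen_nhds [CompactSpace X] [TotallyDisconnectedSpace X]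
    (hK : 𝒢.IsElementary K) (x : X) :
    ∃ U : Set X, IsClopen U ∧ x ∈ U ∧
      ∀ k ∈ K, 𝒢.r k ∈ U → 𝒢.s k ∈ U → k ∈ Set.range 𝒢.unit := by
  have := 𝒢.t2Space_unitSpace
  have hL : IsCompact (K \ Set.range 𝒢.unit) := hK.isCompact.diff 𝒢.isOpen_range_unit
  have hcont : Continuous fun k => (𝒢.r k, 𝒢.s k) :=
    𝒢.isLocalHomeomorph_r.continuous.prodMk 𝒢.isLocalHomeomorph_s.continuous
  have hcl := (hL.image hcont).isClosed
  have hx : (x, x) ∉ (fun k => (𝒢.r k, 𝒢.s k)) '' (K \ Set.range 𝒢.unit) := by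
    rintro ⟨k, ⟨hk, hku⟩, e⟩
    obtain ⟨e₁, e₂⟩ := Prod.ext_iff.1 e
    exact hku (hK.principal k hk (Eq.trans e₁ (Eq.symm e₂)))
  obtain ⟨V, W, hV, hxV, hW, hxW, hVW⟩ :=
    mem_nhds_prod_iff'.1 (hcl.isOpen_compl.mem_nhds hx)
  obtain ⟨U, hU, hxU, hUVW⟩ := compact_exists_isClopen_in_isOpen (hV.inter hW) ⟨hxV, hxW⟩
  refine ⟨U, hU, hxU, fun k hk hr hs => ?_⟩
  by_contra hku
  exact hVW (Set.mk_mem_prod (hUVW hr).1 (hUVW hs).2) ⟨k, ⟨hk, hku⟩, rfl⟩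

/-- A clopen fundamental domain: a clopen set meeting every `K`-orbit in exactly one point. -/
theorem IsElementary.exists_transversal [CompactSpace X] [TotallyDisconnectedSpace X]
    (hK : 𝒢.IsElementary K) :
    ∃ D : Set X, IsClopen D ∧ ∀ x, ∃! k, k ∈ K ∧ 𝒢.s k = x ∧ 𝒢.r k ∈ D := by
  have := 𝒢.t2Space_unitSpace
  suffices H : ∃ D : Set X, IsClopen D ∧
      (∀ k ∈ K, 𝒢.r k ∈ D → 𝒢.s k ∈ D → k ∈ Set.range 𝒢.unit) ∧
      ∀ x ∈ Set.univ, ∃ k ∈ K, 𝒢.s k = x ∧ 𝒢.r k ∈ D by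
    obtain ⟨D, hD, hD1, hD2⟩ := H
    refine ⟨D, hD, fun x => ?_⟩
    obtain ⟨k, hk, hkx, hkD⟩ := hD2 x trivial
    refine ⟨k, ⟨hk, hkx, hkD⟩, fun h ⟨hh, hhx, hhD⟩ => ?_⟩
    have H : 𝒢.s h = 𝒢.s k := hhx.trans hkx.symm
    exact 𝒢.eq_of_div_mem_range_unit H (hD1 _ (hK.div_mem hh hk H)
      (by rwa [𝒢.r_div H]) (by rwa [𝒢.s_div H]))
  refine isCompact_univ.induction_on (p := fun S => ∃ D : Set X, IsClopen D ∧
      (∀ k ∈ K, 𝒢.r k ∈ D → 𝒢.s k ∈ D → k ∈ Set.range 𝒢.unit) ∧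
      ∀ x ∈ S, ∃ k ∈ K, 𝒢.s k = x ∧ 𝒢.r k ∈ D)
    ⟨∅, isClopen_empty, by simp, by simp⟩ ?_ ?_ ?_
  · rintro S T hST ⟨D, hD, hD1, hD2⟩
    exact ⟨D, hD, hD1, fun x hx => hD2 x (hST hx)⟩
  · rintro S T ⟨D, hD, hD1, hD2⟩ ⟨E, hE, hE1, hE2⟩
    -- `sat` is the `K`-saturation of `D`; the part of `E` inside it has to be dropped.
    let sat : Set X := 𝒢.r '' (K ∩ 𝒢.s ⁻¹' D)
    have hpre : IsClopen (K ∩ 𝒢.s ⁻¹' D) :=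
      hK.isClopen.inter (hD.preimage 𝒢.isLocalHomeomorph_s.continuous)
    have hsat : IsClopen sat :=
      ⟨((hK.isCompact.inter_right (hD.preimage 𝒢.isLocalHomeomorph_s.continuous).1).image
        𝒢.isLocalHomeomorph_r.continuous).isClosed, 𝒢.isLocalHomeomorph_r.isOpenMap _ hpre.2⟩
    refine ⟨D ∪ (E \ sat), hD.union (hE.diff hsat), ?_, ?_⟩
    · rintro k hk (hr | ⟨hr, hr'⟩) (hs | ⟨hs, hs'⟩)
      · exact hD1 k hk hr hs
      · exact absurd ⟨𝒢.inv k, ⟨hK.inv_mem k hk, by rwa [Set.mem_preimage, 𝒢.s_inv]⟩,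
          𝒢.r_inv k⟩ hs'
      · exact absurd ⟨k, ⟨hk, hs⟩, rfl⟩ hr'
      · exact hE1 k hk hr hs
    · rintro x (hx | hx)
      · obtain ⟨k, hk, hkx, hkD⟩ := hD2 x hx
        exact ⟨k, hk, hkx, Or.inl hkD⟩
      · obtain ⟨k, hk, hkx, hkE⟩ := hE2 x hx
        by_cases hsk : 𝒢.r k ∈ sat
        · obtain ⟨l, ⟨hl, hlD⟩, hlk⟩ := hsk
          have e : 𝒢.s (𝒢.inv l) = 𝒢.r k := (𝒢.s_inv l).trans hlk
          refine ⟨𝒢.mul (𝒢.inv l) k e, hK.mul_mem _ _ _ (hK.inv_mem l hl) hk,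
            (𝒢.s_mul _ _ _).trans hkx, Or.inl ?_⟩
          rw [𝒢.r_mul, 𝒢.r_inv]
          exact hlD
        · exact ⟨k, hk, hkx, Or.inr ⟨hkE, hsk⟩⟩
  · intro x _
    obtain ⟨U, hU, hxU, hU1⟩ := hK.exists_isClopen_nhds x
    exact ⟨U, mem_nhdsWithin_of_mem_nhds (hU.2.mem_nhds hxU), U, hU, hU1,
      fun y hy => ⟨𝒢.unit y, hK.unit_mem y, 𝒢.s_unit y, by rwa [𝒢.r_unit]⟩⟩

/-! ### Classes in `H₀` and orbit sums -/

/-- If `D` is a transversal of `K`, then `f` is homologous to the function that is supported on `D`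
and collects there the sums of `f` over the `K`-orbits. -/
theorem IsElementary.exists_mk_eq (hK : 𝒢.IsElementary K) {D : Set X} (hD : IsClopen D)
    (hKD : ∀ x, ∃! k, k ∈ K ∧ 𝒢.s k = x ∧ 𝒢.r k ∈ D) (f : C_c(X, ℤ)) :
    ∃ F : C_c(X, ℤ), (QuotientAddGroup.mk F : 𝒢.H0) = QuotientAddGroup.mk f ∧
      ∀ x, F x = D.indicator (𝒢.orbitSum K f) x := by
  have := 𝒢.t2Space
  have := 𝒢.t2Space_unitSpace
  set A : Set G := K ∩ 𝒢.r ⁻¹' D with hA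
  have hAcl : IsClopen A :=
    hK.isClopen.inter (hD.preimage 𝒢.isLocalHomeomorph_r.continuous)
  -- Each value `f x` sits on the arrow of `K` leading from `x` to the point of `D` in its orbit.
  let ψ : C_c(G, ℤ) :=
    { toFun := A.indicator (fun g => f (𝒢.s g))
      continuous_toFun := hAcl.continuous_indicator
        (f.continuous.comp 𝒢.isLocalHomeomorph_s.continuous)
      hasCompactSupport' := HasCompactSupport.intro hK.isCompact fun g hg =>
        Set.indicator_of_notMem (fun h => hg h.1) _ }
  have hψ : ∀ g, ψ g = A.indicator (fun g => f (𝒢.s g)) g := fun _ => rfl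
  have hψA : ∀ g, ψ g ≠ 0 → g ∈ A := fun g hg =>
    by_contra fun h => hg ((hψ g).trans (Set.indicator_of_notMem h _))
  have hs : ∀ x, ∑ᶠ g ∈ 𝒢.s ⁻¹' {x}, ψ g = f x := by
    intro x
    obtain ⟨k, ⟨hk, hkx, hkD⟩, huniq⟩ := hKD x
    have hkA : ψ k = f x := by rw [hψ, Set.indicator_of_mem (show k ∈ A from ⟨hk, hkD⟩), hkx]
    rw [← hkA, ← finsum_mem_singleton (a := k) (f := ψ)]
    refine finsum_mem_inter_support_eq _ _ _ ?_
    ext g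
    constructor
    · rintro ⟨hg, hgψ⟩
      have hgA : g ∈ A := hψA _ hgψ
      exact ⟨huniq g ⟨hgA.1, hg, hgA.2⟩, hgψ⟩
    · rintro ⟨rfl, hgψ⟩
      exact ⟨hkx, hgψ⟩
  have hr : ∀ x, ∑ᶠ g ∈ 𝒢.r ⁻¹' {x}, ψ g = D.indicator (𝒢.orbitSum K f) x := by
    intro x
    have hbij : Set.BijOn 𝒢.inv (𝒢.s ⁻¹' {x}) (𝒢.r ⁻¹' {x}) :=
      ⟨fun g hg => (𝒢.r_inv g).trans hg, (Function.LeftInverse.injective 𝒢.inv_inv).injOn,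
        fun g hg => ⟨𝒢.inv g, (𝒢.s_inv g).trans hg, 𝒢.inv_inv g⟩⟩
    rw [← finsum_mem_eq_of_bijOn (f := fun g => ψ (𝒢.inv g)) _ hbij fun _ _ => rfl]
    by_cases hx : x ∈ D
    · rw [Set.indicator_of_mem hx, orbitSum]
      have hval : ∀ g ∈ 𝒢.sourceFiber K x, f (𝒢.r g) = ψ (𝒢.inv g) := by
        intro g hg
        rw [hψ, Set.indicator_of_mem, 𝒢.s_inv]
        exact ⟨hK.inv_mem g hg.1, by rwa [Set.mem_preimage, 𝒢.r_inv, hg.2]⟩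
      rw [finsum_mem_congr rfl hval]
      refine finsum_mem_inter_support_eq _ _ _ ?_
      ext g
      constructor
      · rintro ⟨hg, hgψ⟩
        have hgA : 𝒢.inv g ∈ A := hψA _ hgψ
        exact ⟨⟨𝒢.inv_inv g ▸ hK.inv_mem _ hgA.1, hg⟩, hgψ⟩
      · rintro ⟨hg, hgψ⟩
        exact ⟨hg.2, hgψ⟩
    · rw [Set.indicator_of_notMem hx]
      refine finsum_mem_eq_zero_of_forall_eq_zero fun g hg => ?_
      rw [hψ, Set.indicator_of_notMem]
      rintro ⟨-, h⟩
      rw [Set.mem_preimage, 𝒢.r_inv, show 𝒢.s g = x from hg] at h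
      exact hx h
  have hb : ∀ x, 𝒢.boundary₁ ψ x = f x - D.indicator (𝒢.orbitSum K f) x := fun x => by
    rw [boundary₁_apply, hs, hr]
  refine ⟨f - 𝒢.boundary₁ ψ, ?_, fun x => ?_⟩
  · rw [QuotientAddGroup.eq]
    exact ⟨ψ, by abel⟩
  · rw [CompactlySupportedContinuousMap.sub_apply, hb]
    abel

theorem mk_mem_H0Pos {f : C_c(X, ℤ)} (hf : ∀ x, 0 ≤ f x) :
    (QuotientAddGroup.mk f : 𝒢.H0) ∈ 𝒢.H0Pos := ⟨f, hf, rfl⟩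

theorem IsElementary.mk_mem_H0Pos [CompactSpace X] [TotallyDisconnectedSpace X]
    (hK : 𝒢.IsElementary K) {f : C_c(X, ℤ)} (hf : ∀ x, 0 ≤ 𝒢.orbitSum K f x) :
    (QuotientAddGroup.mk f : 𝒢.H0) ∈ 𝒢.H0Pos := by
  obtain ⟨D, hD, hKD⟩ := hK.exists_transversal
  obtain ⟨F, hF, hFx⟩ := hK.exists_mk_eq hD hKD f
  refine ⟨F, fun x => ?_, hF⟩
  rw [hFx]
  exact Set.indicator_nonneg (fun x _ => hf x) x

/-- A non-zero positive class has orbit sums bounded below by a multiple of the size of the orbit: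
a non-negative representative has them by minimality, and changing it by a boundary costs
arbitrarily little. -/
theorem IsMinimal.exists_eventually_le_orbitSum_of_mem [CompactSpace X] (hmin : 𝒢.IsMinimal)
    {f : C_c(X, ℤ)} (hf : (QuotientAddGroup.mk f : 𝒢.H0) ∈ 𝒢.H0Pos)
    (hf0 : (QuotientAddGroup.mk f : 𝒢.H0) ≠ 0) :
    ∃ δ : ℝ, 0 < δ ∧ ∀ᶠ K in 𝒢.folner, ∀ x : X,
      δ * (𝒢.sourceFiber K x).ncard ≤ 𝒢.orbitSum K f x := by
  obtain ⟨g, hg, hgf⟩ := hf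
  obtain ⟨φ, hφ⟩ := QuotientAddGroup.eq.1 hgf
  have hg0 : g ≠ 0 := by
    rintro rfl
    exact hf0 hgf.symm
  obtain ⟨δ, hδ, hev⟩ := hmin.exists_eventually_le_orbitSum hg hg0
  refine ⟨δ / 2, by positivity, ?_⟩
  filter_upwards [eventually_isElementary, hev,
    eventually_abs_orbitSum_boundary₁_le φ (half_pos hδ)] with K hK h1 h2 x
  have hfg : (f : X → ℤ) = g + 𝒢.boundary₁ φ := by
    rw [hφ, ← CompactlySupportedContinuousMap.coe_add, add_neg_cancel_left]
  rw [hfg, hK.orbitSum_add]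
  have h3 := h1 x
  have h4 := (abs_le.1 (h2 x)).1
  push_cast
  linarith

/-! ### The order structure of `H₀` -/

theorem add_mem_H0Pos {a b : 𝒢.H0} (ha : a ∈ 𝒢.H0Pos) (hb : b ∈ 𝒢.H0Pos) : a + b ∈ 𝒢.H0Pos := by
  obtain ⟨f, hf, rfl⟩ := ha
  obtain ⟨g, hg, rfl⟩ := hb
  exact ⟨f + g, fun x => add_nonneg (hf x) (hg x), rfl⟩

theorem isOrderedAbelianGroup_H0Pos [CompactSpace X] (haf : 𝒢.IsAlmostFinite) (hmin : 𝒢.IsMinimal) :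
    IsOrderedAbelianGroup 𝒢.H0Pos where
  add_mem _ ha _ hb := add_mem_H0Pos ha hb
  mem_and_neg_mem_iff a := by
    refine ⟨fun ⟨ha, ha'⟩ => ?_, ?_⟩
    · by_contra h0
      obtain ⟨f, rfl⟩ := QuotientAddGroup.mk_surjective a
      -- The bounds on orbit sums contradict each other only at an actual unit.
      have hX : Nonempty X := by
        by_contra hX
        rw [not_nonempty_iff] at hX
        exact h0 (by rw [show f = 0 from DFunLike.ext _ _ fun x => hX.elim x]; rfl)
      obtain ⟨x⟩ := hX
      have h0' : (QuotientAddGroup.mk (-f) : 𝒢.H0) ≠ 0 := neg_ne_zero.2 h0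
      obtain ⟨δ, hδ, hev⟩ := hmin.exists_eventually_le_orbitSum_of_mem ha h0
      obtain ⟨δ', hδ', hev'⟩ := hmin.exists_eventually_le_orbitSum_of_mem (f := -f) ha' h0'
      have := haf.neBot_folner
      obtain ⟨K, hK, h1, h2⟩ := (eventually_isElementary.and (hev.and hev')).exists
      have hpos : (0 : ℝ) < (𝒢.sourceFiber K x).ncard := by
        exact_mod_cast hK.ncard_sourceFiber_pos x
      have h3 := h1 x
      have h4 := h2 x
      have h5 := hK.orbitSum_add f (-f) x
      rw [add_neg_cancel] at h5
      have h6 : 𝒢.orbitSum K 0 x = 0 := by simp [orbitSum]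
      have h7 : (𝒢.orbitSum K f x : ℝ) + 𝒢.orbitSum K (-f) x = 0 := by
        exact_mod_cast h5.symm.trans h6
      rw [CompactlySupportedContinuousMap.coe_neg] at h4
      have := mul_pos hδ hpos
      have := mul_pos hδ' hpos
      linarith
    · rintro rfl
      have h : (0 : 𝒢.H0) ∈ 𝒢.H0Pos := ⟨0, fun _ => le_rfl, rfl⟩
      exact ⟨h, by rwa [neg_zero]⟩
  exists_sub a := by
    obtain ⟨f, rfl⟩ := QuotientAddGroup.mk_surjective a
    refine ⟨_, mk_mem_H0Pos (f := f ⊔ 0) fun x => le_max_right _ _, _,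
      mk_mem_H0Pos (f := (f ⊔ 0) - f) fun x => sub_nonneg.2 (le_max_left _ _), ?_⟩
    rw [← QuotientAddGroup.mk_sub, sub_sub_cancel]

theorem isSimpleOrdered_H0Pos [CompactSpace X] [TotallyDisconnectedSpace X]
    (haf : 𝒢.IsAlmostFinite) (hmin : 𝒢.IsMinimal) :
    IsSimpleOrdered 𝒢.H0Pos := by
  rintro u ⟨hu, hu0⟩
  refine ⟨hu, fun a => ?_⟩
  rw [ConeLE, sub_zero] at hu
  obtain ⟨f, rfl⟩ := QuotientAddGroup.mk_surjective u
  obtain ⟨g, rfl⟩ := QuotientAddGroup.mk_surjective a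
  obtain ⟨δ, hδ, hev⟩ := hmin.exists_eventually_le_orbitSum_of_mem hu hu0.symm
  have := haf.neBot_folner
  obtain ⟨K, hK, h⟩ := (eventually_isElementary.and hev).exists
  obtain ⟨M, hM⟩ := exists_abs_le g
  obtain ⟨n, hn⟩ := exists_nat_ge (M / δ)
  have hbound : ∀ x, |𝒢.orbitSum K g x| ≤ n * 𝒢.orbitSum K f x := by
    intro x
    have h1 := hK.abs_orbitSum_le (f := g) (M := M) (fun x => by exact_mod_cast hM x) x
    have h2 : (M : ℝ) * (𝒢.sourceFiber K x).ncard ≤ n * 𝒢.orbitSum K f x :=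
      calc (M : ℝ) * (𝒢.sourceFiber K x).ncard
          ≤ n * δ * (𝒢.sourceFiber K x).ncard := by
            gcongr
            exact (div_le_iff₀ hδ).1 hn
        _ = n * (δ * (𝒢.sourceFiber K x).ncard) := by ring
        _ ≤ _ := by
            gcongr
            exact h x
    exact_mod_cast h1.trans h2
  refine ⟨n, ?_, ?_⟩
  · have : (QuotientAddGroup.mk (g + n • f) : 𝒢.H0) ∈ 𝒢.H0Pos := by
      refine hK.mk_mem_H0Pos fun x => ?_
      rw [CompactlySupportedContinuousMap.coe_add, CompactlySupportedContinuousMap.coe_smul,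
        hK.orbitSum_add, hK.orbitSum_nsmul]
      linarith [(abs_le.1 (hbound x)).1]
    rw [ConeLE, sub_neg_eq_add]
    exact this
  · have : (QuotientAddGroup.mk (n • f - g) : 𝒢.H0) ∈ 𝒢.H0Pos := by
      refine hK.mk_mem_H0Pos fun x => ?_
      rw [CompactlySupportedContinuousMap.coe_sub, CompactlySupportedContinuousMap.coe_smul,
        hK.orbitSum_sub, hK.orbitSum_nsmul]
      linarith [(abs_le.1 (hbound x)).2]
    exact this

theorem isWeaklyUnperforated_H0Pos [CompactSpace X] [TotallyDisconnectedSpace X]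
    (haf : 𝒢.IsAlmostFinite) (hmin : 𝒢.IsMinimal) :
    IsWeaklyUnperforated 𝒢.H0Pos := by
  rintro a n hn ⟨ha, ha0⟩
  refine ⟨?_, ?_⟩
  · rw [ConeLE, sub_zero] at ha ⊢
    obtain ⟨f, rfl⟩ := QuotientAddGroup.mk_surjective a
    obtain ⟨δ, hδ, hev⟩ := hmin.exists_eventually_le_orbitSum_of_mem (f := n • f) ha ha0.symm
    have := haf.neBot_folner
    obtain ⟨K, hK, h⟩ := (eventually_isElementary.and hev).exists
    refine hK.mk_mem_H0Pos fun x => ?_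
    have h1 := h x
    rw [CompactlySupportedContinuousMap.coe_smul, hK.orbitSum_nsmul] at h1
    have h2 : (0 : ℝ) ≤ δ * (𝒢.sourceFiber K x).ncard := by positivity
    have h3 : 0 ≤ (n : ℤ) * 𝒢.orbitSum K f x := by exact_mod_cast h2.trans h1
    exact nonneg_of_mul_nonneg_right h3 (by exact_mod_cast hn)
  · rintro rfl
    exact ha0 (smul_zero n).symm

theorem hasRieszInterpolation_H0Pos [CompactSpace X] [TotallyDisconnectedSpace X]
    (haf : 𝒢.IsAlmostFinite) (hmin : 𝒢.IsMinimal) :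
    HasRieszInterpolation 𝒢.H0Pos := by
  intro a b hab
  -- An equality `a i = b j` must be treated separately: orbit sums only detect strict positivity.
  by_cases heq : ∃ i j, a i = b j
  · obtain ⟨i, j, hij⟩ := heq
    exact ⟨a i, fun i' => hij ▸ hab i' j, fun j' => hab i j'⟩
  · push Not at heq
    choose f hf using fun i => QuotientAddGroup.mk_surjective (a i)
    choose g hg using fun j => QuotientAddGroup.mk_surjective (b j)
    have hev : ∀ i j, ∀ᶠ K in 𝒢.folner, ∀ x, 0 ≤ 𝒢.orbitSum K (g j - f i : C_c(X, ℤ)) x := by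
      intro i j
      have hmk : (QuotientAddGroup.mk (g j - f i) : 𝒢.H0) = b j - a i := by
        rw [QuotientAddGroup.mk_sub, hf, hg]
      obtain ⟨δ, hδ, h⟩ := hmin.exists_eventually_le_orbitSum_of_mem (f := g j - f i)
        (hmk ▸ hab i j) (hmk ▸ sub_ne_zero.2 (heq i j).symm)
      filter_upwards [h] with K hK x
      have h0 : (0 : ℝ) ≤ δ * (𝒢.sourceFiber K x).ncard := by positivity
      exact_mod_cast h0.trans (hK x)
    have := haf.neBot_folner
    obtain ⟨K, hK, h⟩ := (eventually_isElementary.and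
      (Filter.eventually_all.2 fun i => Filter.eventually_all.2 (hev i))).exists
    obtain ⟨D, hD, hKD⟩ := hK.exists_transversal
    choose F hF hFx using fun i => hK.exists_mk_eq hD hKD (f i)
    choose E hE hEx using fun j => hK.exists_mk_eq hD hKD (g j)
    have hFE : ∀ i j x, F i x ≤ E j x := by
      intro i j x
      rw [hFx, hEx]
      refine Set.indicator_le_indicator ?_
      have := h i j x
      rwa [CompactlySupportedContinuousMap.coe_sub, hK.orbitSum_sub, sub_nonneg] at this
    refine ⟨QuotientAddGroup.mk (F 0 ⊔ F 1), fun i => ?_, fun j => ?_⟩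
    · rw [ConeLE, ← hf, ← hF, ← QuotientAddGroup.mk_sub]
      refine mk_mem_H0Pos fun x => sub_nonneg.2 ?_
      fin_cases i
      · exact le_max_left _ _
      · exact le_max_right _ _
    · rw [ConeLE, ← hg, ← hE, ← QuotientAddGroup.mk_sub]
      exact mk_mem_H0Pos fun x => sub_nonneg.2 (max_le (hFE 0 j x) (hFE 1 j x))

end EtaleGroupoid

theorem proposition6p10 {X G : Type*} [TopologicalSpace X] [TopologicalSpace G]
    [CompactSpace X] [TotallyDisconnectedSpace X] [SecondCountableTopology G]
    (𝒢 : EtaleGroupoid X G) (haf : 𝒢.IsAlmostFinite) (hmin : 𝒢.IsMinimal) :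
    IsOrderedAbelianGroup 𝒢.H0Pos ∧ IsSimpleOrdered 𝒢.H0Pos ∧
      IsWeaklyUnperforated 𝒢.H0Pos ∧ HasRieszInterpolation 𝒢.H0Pos :=
  ⟨EtaleGroupoid.isOrderedAbelianGroup_H0Pos haf hmin,
    EtaleGroupoid.isSimpleOrdered_H0Pos haf hmin,
    EtaleGroupoid.isWeaklyUnperforated_H0Pos haf hmin,
    EtaleGroupoid.hasRieszInterpolation_H0Pos haf hmin⟩
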